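/- A $6$-nilmanifold is a compact quotient $M=\Gamma\backslash G$ of a simply connected nilpotent Lie group $G$ of real dimension $6$ by a discrete subgroup $\Gamma$. An almost complex structure on $M$ is a smooth field $J$ of endomorphisms of $TM$ with $J^2=-\mathrm{Id}$; it is left-invariant if its lift to $G$ is invariant under all left translations of $G$. Its Nijenhuis tensor is $$N_J(X,Y)=[JX,JY]-J[JX,Y]-J[X,JY]-[X,Y],$$ and $\operatorname{rk} N_J|_x$ is the dimension over $\mathbb{C}$ of the image of $N_J|_x\colon T_xM\otimes T_xM\to T_xM$, a $J$-stable subspace of $T_xM$ (so it is half the real dimension of the image; equivalently, it is the rank over $\mathbb{C}$ of $\bar\mu=\pi^{0,2}\circ d\colon A^{1,0}_x\to A^{0,2}_x$). We say that $J$ has rank $k$ if $\operatorname{rk} N_J|_x=k$ at every $x\in M$. The space of almost complex structures on $M$ carries the $C^\infty$ topology (uniform convergence of all derivatives, in charts). **Proposition.** For all $k_0\le k_1$ in $\{0,1,2,3\}$ there exist a $6$-nilmanifold $M$, depending on $k_0,k_1$, and a left-invariant almost complex structure $J_0$ on $M$ of rank $k_0$ such that every neighborhood of $J_0$ contains a left-invariant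 almost complex structure on $M$ of rank $k_1$. -/

import Mathlib

open scoped Manifold ContDiff Topology
open MulAction

noncomputable section

namespace Nilmanifolds

/-- If `f : X → Y` is a local homeomorphism and any two points in the same fibre of `f` are
exchanged by a smooth map `X → X` over `Y`, then the charts of `X`, composed with the local inverses
of `f`, have smooth transition maps. -/
theorem isManifold_of_isLocalHomeomorph {n : ℕ} {X Y : Type*}
    [TopologicalSpace X] [ChartedSpace (EuclideanSpace ℝ (Fin n)) X] [IsManifold (𝓡 n) ∞ X]
    [TopologicalSpace Y] {f : X → Y} (hf : IsLocalHomeomorph f)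
    (hφ : ∀ a b, f a = f b → ∃ φ : X → X, ContMDiff (𝓡 n) (𝓡 n) ∞ φ ∧ φ a = b ∧
      ∀ z, f (φ z) = f z)
    {g : Y → X} (hg : Function.RightInverse g f) :
    letI : ChartedSpace (EuclideanSpace ℝ (Fin n)) Y := hf.chartedSpaceOfRightInverse hg
    IsManifold (𝓡 n) ∞ Y := by
  let _ : ChartedSpace (EuclideanSpace ℝ (Fin n)) Y := hf.chartedSpaceOfRightInverse hg
  apply isManifold_of_contDiffOn
  rintro e e' ⟨q, rfl⟩ ⟨q', rfl⟩
  generalize g q = a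
  generalize g q' = a'
  intro y hy
  apply ContDiffAt.contDiffWithinAt
  simp only [OpenPartialHomeomorph.trans_source, OpenPartialHomeomorph.trans_symm_eq_symm_trans_symm,
    OpenPartialHomeomorph.symm_source, Set.mem_inter_iff, Set.mem_preimage,
    OpenPartialHomeomorph.coe_trans, Function.comp_apply, IsLocalHomeomorph.localInverseAt_symm,
    modelWithCornersSelf_coe, modelWithCornersSelf_coe_symm, id] at hy
  obtain ⟨⟨⟨hy1, hy2⟩, hy3, hy4⟩, -⟩ := hy
  set c := chartAt (EuclideanSpace ℝ (Fin n)) a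
  set c' := chartAt (EuclideanSpace ℝ (Fin n)) a'
  set L' := hf.localInverseAt a'
  obtain ⟨φ, hφs, hφa, hφf⟩ := hφ (c.symm y) (L' (f (c.symm y)))
    (hf.apply_localInverseAt_of_mem hy3).symm
  have hcs : ContMDiffAt 𝓘(ℝ, EuclideanSpace ℝ (Fin n)) (𝓡 n) ∞ c.symm y :=
    (contMDiffOn_chart_symm (I := 𝓡 n) (n := ∞) (x := a)).contMDiffAt (c.open_target.mem_nhds hy1)
  have hc' : ContMDiffAt (𝓡 n) 𝓘(ℝ, EuclideanSpace ℝ (Fin n)) ∞ c' (φ (c.symm y)) := by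
    rw [hφa]
    exact (contMDiffOn_chart (I := 𝓡 n) (n := ∞) (x := a')).contMDiffAt
      (c'.open_source.mem_nhds hy4)
  have key : ContMDiffAt 𝓘(ℝ, EuclideanSpace ℝ (Fin n)) 𝓘(ℝ, EuclideanSpace ℝ (Fin n)) ∞
      (fun z => c' (φ (c.symm z))) y :=
    ContMDiffAt.comp y hc' ((hφs _).comp y hcs)
  refine (contMDiffAt_iff_contDiffAt.mp key).congr_of_eventuallyEq ?_
  have hmem : ∀ᶠ z in 𝓝 y, φ (c.symm z) ∈ L'.target := by
    have h1 : ContinuousAt (fun z => φ (c.symm z)) y :=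
      ((hφs _).comp y hcs).continuousAt
    refine h1 (L'.open_target.mem_nhds ?_)
    change φ (c.symm y) ∈ _
    rw [hφa]
    exact L'.map_source hy3
  filter_upwards [hmem] with z hz
  have : L' (f (c.symm z)) = φ (c.symm z) := by
    rw [← hφf, ← hf.localInverseAt_symm a']
    exact L'.right_inv hz
  simp [OpenPartialHomeomorph.trans_symm_eq_symm_trans_symm, c, c', L'] at this ⊢
  rw [this]

/-! ### Nilmanifolds -/

/-- The data `(G, Γ)` of a nilmanifold `Γ \ G` of real dimension `n`: a simply connected nilpotent
(real, smooth, Hausdorff) Lie group `G` of dimension `n` and a discrete subgroup `Γ` of `G`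
such that `Γ \ G` is compact. -/
structure Nilmanifold (n : ℕ) where
  G : Type
  [group : Group G]
  [topology : TopologicalSpace G]
  [charted : ChartedSpace (EuclideanSpace ℝ (Fin n)) G]
  [lieGroup : LieGroup (𝓡 n) ∞ G]
  [hausdorff : T2Space G]
  [simplyConnected : SimplyConnectedSpace G]
  [nilpotent : Group.IsNilpotent G]
  Γ : Subgroup G
  [discrete : DiscreteTopology Γ]
  [compact : CompactSpace (orbitRel.Quotient Γ G)]

namespace Nilmanifold

attribute [instance] group topology charted lieGroup hausdorff simplyConnected nilpotent
  discrete compact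

variable {n : ℕ} (N : Nilmanifold n)

instance : IsTopologicalGroup N.G := topologicalGroup_of_lieGroup (𝓡 n) ∞

instance : LocallyCompactSpace N.G := Manifold.locallyCompact_of_finiteDimensional (𝓡 n)

instance : ProperlyDiscontinuousSMul N.Γ N.G :=
  N.Γ.properlyDiscontinuousSMul_of_tendsto_cofinite
    (N.Γ.tendsto_coe_cofinite_of_discrete
      (SetLike.isDiscrete_iff_discreteTopology.mpr inferInstance))

/-- The manifold `M = Γ \ G`, i.e. the set of orbits `Γ g` of the action of `Γ` on `G` by left
multiplication, with the quotient topology and with the charts obtained by composing the local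
inverses of the projection `G → Γ \ G` with the charts of `G`. -/
abbrev M : Type := orbitRel.Quotient N.Γ N.G


/-- The projection `G → Γ \ G`. -/
def proj (g : N.G) : N.M := Quotient.mk _ g

/-- The smooth structure of `Γ \ G`. -/
instance : IsManifold (𝓡 n) ∞ N.M :=
  isManifold_of_isLocalHomeomorph
    (isQuotientCoveringMap_quotientMk_of_properlyDiscontinuousSMul
      (E := N.G) (G := N.Γ)).isCoveringMap.isLocalHomeomorph
    (fun a b hab => by
      obtain ⟨γ, hγ⟩ := Quotient.exact hab.symm
      refine ⟨fun g => γ • g, contMDiff_mul_left (a := (γ : N.G)), hγ, fun z => ?_⟩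
      exact Quotient.sound ⟨γ, rfl⟩)
    Quotient.mk_surjective.hasRightInverse.choose_spec

end Nilmanifold
/-! ### Almost complex structures and the Nijenhuis tensor -/

section AlmostComplex

variable (n : ℕ) (M : Type*) [TopologicalSpace M] [ChartedSpace (EuclideanSpace ℝ (Fin n)) M]
  [IsManifold (𝓡 n) ∞ M]

/-- A (smooth) almost complex structure on `M`: a smooth section `J` of `End(TM)` with
`J² = -Id`. -/
structure AlmostComplexStructure where
  toFun : ∀ x : M, TangentSpace (𝓡 n) x →L[ℝ] TangentSpace (𝓡 n) x
  smooth : ContMDiff (𝓡 n)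
    ((𝓡 n).prod 𝓘(ℝ, EuclideanSpace ℝ (Fin n) →L[ℝ] EuclideanSpace ℝ (Fin n))) ∞
    (fun x => Bundle.TotalSpace.mk' (EuclideanSpace ℝ (Fin n) →L[ℝ] EuclideanSpace ℝ (Fin n))
      (E := fun x : M => TangentSpace (𝓡 n) x →L[ℝ] TangentSpace (𝓡 n) x) x (toFun x))
  sq_eq_neg : ∀ (x : M) (v : TangentSpace (𝓡 n) x), toFun x (toFun x v) = -v

namespace AlmostComplexStructure

variable {n M}

/-- The vector field `J X`. -/
def applyField (J : AlmostComplexStructure n M) (X : ∀ x : M, TangentSpace (𝓡 n) x) :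
    ∀ x : M, TangentSpace (𝓡 n) x := fun x => J.toFun x (X x)

/-- The Nijenhuis tensor
`N_J(X, Y) = [JX, JY] - J[JX, Y] - J[X, JY] - [X, Y]`
evaluated on two vector fields. -/
def nijenhuis (J : AlmostComplexStructure n M) (X Y : ∀ x : M, TangentSpace (𝓡 n) x) :
    ∀ x : M, TangentSpace (𝓡 n) x := fun x =>
  VectorField.mlieBracket (𝓡 n) (J.applyField X) (J.applyField Y) x
    - J.toFun x (VectorField.mlieBracket (𝓡 n) (J.applyField X) Y x)
    - J.toFun x (VectorField.mlieBracket (𝓡 n) X (J.applyField Y) x)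
    - VectorField.mlieBracket (𝓡 n) X Y x

/-- The image of `N_J : T_x M ⊗ T_x M → T_x M`: the real subspace of `T_x M` spanned by the values
at `x` of `N_J(X, Y)`, for `X`, `Y` smooth vector fields. -/
def nijenhuisImage (J : AlmostComplexStructure n M) (x : M) :
    Submodule ℝ (TangentSpace (𝓡 n) x) :=
  Submodule.span ℝ {v | ∃ X Y : ∀ y : M, TangentSpace (𝓡 n) y,
    ContMDiff (𝓡 n) (𝓡 n).tangent ∞ (fun y => (⟨y, X y⟩ : TangentBundle (𝓡 n) M)) ∧
    ContMDiff (𝓡 n) (𝓡 n).tangent ∞ (fun y => (⟨y, Y y⟩ : TangentBundle (𝓡 n) M)) ∧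
    J.nijenhuis X Y x = v}

/-- `rk N_J = k` at every point of `M`. The rank is the complex one: the image of `N_J` at `x` is
stable under `J` (as `N_J(JX, Y) = -J N_J(X, Y)`), and `rk N_J` is its dimension as a complex vector
space, that is, half its real dimension. It is also the complex rank of
`μ̄ = π^{0,2} ∘ d : A^{1,0}_x → A^{0,2}_x`. -/
def HasRank (J : AlmostComplexStructure n M) (k : ℕ) : Prop :=
  ∀ x : M, Module.finrank ℝ (J.nijenhuisImage x) = 2 * k

/-- The local expression of `J` in the chart `φ` around `x₀`: the map `y ↦ dφ ∘ J ∘ dφ⁻¹`, taken at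
the point `φ⁻¹(y)`, from the target of `φ` to the endomorphisms of `ℝⁿ` (its values outside the
target are irrelevant). -/
def localRep (J : AlmostComplexStructure n M) (x₀ : M) (y : EuclideanSpace ℝ (Fin n)) :
    EuclideanSpace ℝ (Fin n) →L[ℝ] EuclideanSpace ℝ (Fin n) :=
  (mfderiv (𝓡 n) (𝓡 n) (chartAt (EuclideanSpace ℝ (Fin n)) x₀)
      ((chartAt (EuclideanSpace ℝ (Fin n)) x₀).symm y)).comp
    ((J.toFun ((chartAt (EuclideanSpace ℝ (Fin n)) x₀).symm y)).comp
      (mfderiv (𝓡 n) (𝓡 n) (chartAt (EuclideanSpace ℝ (Fin n)) x₀).symm y))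

/-- The `C^∞` topology on the space of almost complex structures: uniform convergence on compact
sets, in charts, of the local expressions and of all their derivatives. -/
instance : TopologicalSpace (AlmostComplexStructure n M) :=
  ⨅ (x₀ : M) (m : ℕ), TopologicalSpace.induced
    (fun J => UniformOnFun.ofFun
      {K : Set (EuclideanSpace ℝ (Fin n)) |
        IsCompact K ∧ K ⊆ (chartAt (EuclideanSpace ℝ (Fin n)) x₀).target}
      (iteratedFDeriv ℝ m (J.localRep x₀)))
    inferInstance

end AlmostComplexStructure

end AlmostComplex

/-! ### Left-invariant almost complex structures -/

/-- An almost complex structure `J` on `Γ \ G` is left-invariant if its lift `J'` to `G`, that is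
the field of endomorphisms of `TG` with `dπ ∘ J' = J ∘ dπ` for the projection `π : G → Γ \ G`, is
invariant under all left multiplications of `G`. -/
def Nilmanifold.IsLeftInvariant {n : ℕ} (N : Nilmanifold n) (J : AlmostComplexStructure n N.M) :
    Prop :=
  ∃ J' : ∀ g : N.G, TangentSpace (𝓡 n) g →L[ℝ] TangentSpace (𝓡 n) g,
    (∀ (g : N.G) (v : TangentSpace (𝓡 n) g),
      mfderiv (𝓡 n) (𝓡 n) N.proj g (J' g v) =
        J.toFun (N.proj g) (mfderiv (𝓡 n) (𝓡 n) N.proj g v)) ∧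
    ∀ (h g : N.G) (v : TangentSpace (𝓡 n) g),
      mfderiv (𝓡 n) (𝓡 n) (fun a : N.G => h * a) g (J' g v) =
        J' (h * g) (mfderiv (𝓡 n) (𝓡 n) (fun a : N.G => h * a) g v)

end Nilmanifolds

end

/-!
The groups are `1 + A` for nilpotent associative algebras `A` on `ℝ⁶`: the product is
`x * y = x + y + x y`, so that left multiplications are affine maps, with linear part `1 + L_x`
(`leftDeriv`), and the Lie bracket at the identity is the commutator of `A`. If the structure
constants are integral and triangular, the integer points form a cocompact lattice.

A linear complex structure `j` on `ℝ⁶` extends to the left-invariant structure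
`y ↦ (1 + L_y) j (1 + L_y)⁻¹` on the group, which descends to the quotient (`leftInvariant`). In the
charts of the quotient its local expression is given by this same formula, which is linear in `j`
and polynomial in `y`; hence the structure on the quotient depends continuously on `j` for the `C^∞`
topology (`continuous_leftInvariant`). Writing vector fields in the left-invariant frame shows that
the Nijenhuis tensor is the algebraic one of `j` (`coord_nijenhuis`), so its rank is that of
a bilinear map on `ℝ⁶` (`hasRank_leftInvariant`).

It remains to find a path `j_t` of linear complex structures whose rank is `k₀` at `t = 0` and `k₁`
for `t ≠ 0` (`exists_leftInvariant_of_path`).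

* For `k₀ ≤ 1`, the algebra `twoStep a b c` has brackets `[e₀, e₂] = a e₃`, `[e₁, e₂] = b e₄`,
  `[e₀, e₁] = c e₅`, and `Z = ⟨e₃, e₄, e₅⟩` is central. If `j Z ∩ Z = 0`, then `N(u, v) = -[u, v]`
  for `u, v ∈ j Z`, and the rank is the number of nonzero constants among `a, b, c`. If instead
  `j e₀ = e₁`, `j e₃ = e₄`, `j e₂ = e₅`, then `N` is determined by
  `N(e₀, e₂) = -([e₀, e₂] + j [e₁, e₂]) = (b - a) e₃`, so the rank is `0` or `1`. The path
  `twoStepPath` joins the second situation, at `t = 0`, to the first.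
* For `k₀ ≥ 2`, on strictly upper triangular `4 × 4` matrices the path `upperTriangularPath` has
  rank `2` at `t = 0` and rank `3` elsewhere; constant paths serve for `k₀ = k₁`.
-/

noncomputable section

namespace Nilmanifolds

/-! ### Nilmanifolds of nilpotent associative algebras -/

/-- An associative algebra structure on `ℝⁿ` in which all products of four elements vanish. The
product is integral on `ℤⁿ` and triangular for the standard basis: the `i`-th coordinate of `x y`
depends only on the coordinates of index `< i` of `x` and `y`. The triangularity is phrased as
`F_m A + A F_m ⊆ F_{m+1}` for the filtration `F_m = {x | x i = 0 for i < m}`. -/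
structure NilpotentAlgebra (n : ℕ) where
  mul : EuclideanSpace ℝ (Fin n) →L[ℝ] EuclideanSpace ℝ (Fin n) →L[ℝ] EuclideanSpace ℝ (Fin n)
  mul_assoc : ∀ x y z, mul (mul x y) z = mul x (mul y z)
  mul_mul_mul_eq_zero : ∀ x y z w, mul (mul (mul x y) z) w = 0
  mul_left_triangular : ∀ (m : ℕ) (x y : EuclideanSpace ℝ (Fin n)),
    (∀ i : Fin n, (i : ℕ) < m → x i = 0) → ∀ i : Fin n, (i : ℕ) ≤ m → mul x y i = 0
  mul_right_triangular : ∀ (m : ℕ) (x y : EuclideanSpace ℝ (Fin n)),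
    (∀ i : Fin n, (i : ℕ) < m → y i = 0) → ∀ i : Fin n, (i : ℕ) ≤ m → mul x y i = 0
  mul_integral : ∀ x y : EuclideanSpace ℝ (Fin n), (∀ i, ∃ k : ℤ, x i = k) →
    (∀ i, ∃ k : ℤ, y i = k) → ∀ i, ∃ k : ℤ, mul x y i = k

namespace NilpotentAlgebra

variable {n : ℕ} (D : NilpotentAlgebra n)

local notation "𝔼" => EuclideanSpace ℝ (Fin n)

/-- The product of the group `1 + A`, in terms of the elements of `A`. -/
def op (x y : 𝔼) : 𝔼 := x + y + D.mul x y

/-- The inverse in the group `1 + A`: `(1 + x)⁻¹ = 1 - x + x² - x³`, as `x⁴ = 0`. -/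
def inv (x : 𝔼) : 𝔼 := -x + D.mul x x - D.mul (D.mul x x) x

/-- The group `1 + A`, on the underlying set `ℝⁿ` of `A`. -/
@[reducible] def group : Group (EuclideanSpace ℝ (Fin n)) where
  mul := D.op
  one := 0
  inv := D.inv
  mul_assoc x y z := by
    change (x + y + D.mul x y) + z + D.mul (x + y + D.mul x y) z =
      x + (y + z + D.mul y z) + D.mul x (y + z + D.mul y z)
    simp only [map_add, _root_.add_apply, D.mul_assoc]
    abel
  one_mul x := by
    change 0 + x + D.mul 0 x = x
    simp
  mul_one x := by
    change x + 0 + D.mul x 0 = x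
    simp
  inv_mul_cancel x := by
    change (-x + D.mul x x - D.mul (D.mul x x) x) + x +
      D.mul (-x + D.mul x x - D.mul (D.mul x x) x) x = 0
    simp only [map_add, map_sub, map_neg, _root_.add_apply,
      _root_.sub_apply, _root_.neg_apply, D.mul_mul_mul_eq_zero]
    abel

theorem lieGroup : letI := D.group; LieGroup (𝓡 n) ∞ 𝔼 := by
  let := D.group
  have hA : ContDiff ℝ ∞ (fun x : 𝔼 => D.mul x) := D.mul.contDiff
  refine { contMDiff_mul := ?_, contMDiff_inv := ?_ }
  · have : ContMDiff ((𝓡 n).prod (𝓡 n)) (𝓡 n) ∞ fun p : 𝔼 × 𝔼 => p.1 + p.2 + D.mul p.1 p.2 := by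
      rw [← modelWithCornersSelf_prod, chartedSpaceSelf_prod]
      refine ContDiff.contMDiff ?_
      exact (contDiff_fst.add contDiff_snd).add ((hA.comp contDiff_fst).clm_apply contDiff_snd)
    exact this
  · have : ContMDiff (𝓡 n) (𝓡 n) ∞ fun x : 𝔼 => -x + D.mul x x - D.mul (D.mul x x) x := by
      refine ContDiff.contMDiff ?_
      have h2 : ContDiff ℝ ∞ fun x : 𝔼 => D.mul x x := hA.clm_apply contDiff_id
      exact (contDiff_neg.add h2).sub ((hA.comp h2).clm_apply contDiff_id)
    exact this

/-- A vector with integer coordinates. -/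
def IsIntegral (x : 𝔼) : Prop := ∀ i, ∃ k : ℤ, x i = k

theorem IsIntegral.add {x y : 𝔼} (hx : IsIntegral x) (hy : IsIntegral y) :
    IsIntegral (x + y) := fun i => by
  obtain ⟨a, ha⟩ := hx i
  obtain ⟨b, hb⟩ := hy i
  exact ⟨a + b, by simp [ha, hb]⟩

theorem IsIntegral.neg {x : 𝔼} (hx : IsIntegral x) : IsIntegral (-x) := fun i => by
  obtain ⟨a, ha⟩ := hx i
  exact ⟨-a, by simp [ha]⟩

theorem IsIntegral.mul {x y : 𝔼} (hx : IsIntegral x) (hy : IsIntegral y) :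
    IsIntegral (D.mul x y) := D.mul_integral x y hx hy

/-- The subgroup of integer points of `1 + A`. -/
def lattice : letI := D.group; Subgroup 𝔼 :=
  letI := D.group
  { carrier := {x | IsIntegral x}
    mul_mem' := fun {x y} hx hy => (hx.add hy).add (IsIntegral.mul D hx hy)
    one_mem' := fun _ => ⟨0, by simp [show (1 : 𝔼) = 0 from rfl]⟩
    inv_mem' := fun {x} hx => by
      have h2 := IsIntegral.mul D hx hx
      have : IsIntegral (-x + D.mul x x + -D.mul (D.mul x x) x) :=
        (hx.neg.add h2).add (IsIntegral.mul D h2 hx).neg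
      rw [← sub_eq_add_neg] at this
      exact this }

theorem discreteTopology_lattice : letI := D.group; DiscreteTopology D.lattice := by
  let := D.group
  refine DiscreteTopology.of_forall_le_dist (r := 1) one_pos ?_
  rintro ⟨x, hx⟩ ⟨y, hy⟩ hxy
  have hne : x ≠ y := fun h => hxy (Subtype.ext h)
  obtain ⟨i, hi⟩ : ∃ i, x i ≠ y i := by
    by_contra! h
    exact hne (by ext i; exact h i)
  obtain ⟨a, ha⟩ := hx i
  obtain ⟨b, hb⟩ := hy i
  change 1 ≤ dist x y
  have h1 : ‖(x - y) i‖ ≤ ‖x - y‖ := PiLp.norm_apply_le (x - y) i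
  rw [dist_eq_norm]
  refine le_trans ?_ h1
  rw [ha, hb] at hi
  have hab : a - b ≠ 0 := by
    intro h
    exact hi (by rw [sub_eq_zero.mp h])
  have := Int.one_le_abs hab
  rw [PiLp.sub_apply, ha, hb, Real.norm_eq_abs]
  exact_mod_cast this

/-- The subgroups `{x | x i = 0 for i < n - k}` form an ascending central series. -/
theorem isNilpotent : letI := D.group; Group.IsNilpotent 𝔼 := by
  let := D.group
  rw [Subgroup.nilpotent_iff_finite_ascending_central_series]
  have hmul : ∀ x y : 𝔼, x * y = x + y + D.mul x y := fun _ _ => rfl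
  have hinv : ∀ x : 𝔼, x⁻¹ = -x + D.mul x x - D.mul (D.mul x x) x := fun _ => rfl
  let F : ℕ → Subgroup 𝔼 := fun k =>
    { carrier := {x | ∀ i : Fin n, (i : ℕ) < n - k → x i = 0}
      mul_mem' := fun {x y} hx hy i hi => by
        rw [hmul]
        simp [hx i hi, hy i hi, D.mul_left_triangular _ x y hx i hi.le]
      one_mem' := fun i hi => by simp [show (1 : 𝔼) = 0 from rfl]
      inv_mem' := fun {x} hx i hi => by
        rw [hinv]
        simp [hx i hi, D.mul_left_triangular _ x x hx i hi.le,
          D.mul_right_triangular _ (D.mul x x) x hx i hi.le] }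
  refine ⟨n, F, ⟨?_, ?_⟩, ?_⟩
  · rw [eq_bot_iff]
    intro x hx
    rw [Subgroup.mem_bot]
    change x = 0
    ext i
    exact hx i (by simp)
  · intro x k hx g i hi
    have hx' : ∀ i : Fin n, (i : ℕ) < n - (k + 1) → x i = 0 := hx
    have hi' : (i : ℕ) ≤ n - (k + 1) := by omega
    -- `x g x⁻¹ g⁻¹ = 1 + (x g - g x) (g x)⁻¹`
    have key : x * g * x⁻¹ * g⁻¹ = (D.mul x g - D.mul g x) +
        D.mul (D.mul x g - D.mul g x) (x⁻¹ * g⁻¹) := by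
      have h1 : x * g = g * x + (D.mul x g - D.mul g x) := by
        rw [hmul, hmul]; abel
      have h2 : ∀ u w z : 𝔼, (u + w) * z = u * z + w + D.mul w z := by
        intro u w z
        simp only [hmul, map_add, _root_.add_apply]
        abel
      have h4 : g * x * (x⁻¹ * g⁻¹) = 0 := by group; rfl
      rw [_root_.mul_assoc (x * g), h1, h2, h4, zero_add]
    rw [commutatorElement_def, key]
    have h3 : ∀ i : Fin n, (i : ℕ) ≤ n - (k + 1) → (D.mul x g - D.mul g x) i = 0 := fun j hj => by
      simp [D.mul_left_triangular _ x g hx' j hj, D.mul_right_triangular _ g x hx' j hj]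
    rw [PiLp.add_apply, h3 i hi',
      D.mul_left_triangular _ _ _ (fun j hj => h3 j hj.le) i hi', add_zero]
  · rw [eq_top_iff]
    intro x _ i hi
    simp at hi

/-- Every orbit of the lattice meets the unit cube: the coordinates of `γ` can be chosen one after
the other, since changing the `k`-th one does not affect the coordinates of index `≤ k` of the
product `γ v` in `A`. -/
theorem exists_integral_mul_mem_cube (v : 𝔼) (k : ℕ) :
    ∃ γ : 𝔼, IsIntegral γ ∧ ∀ i : Fin n, (i : ℕ) < k →
      (γ + v + D.mul γ v) i ∈ Set.Icc (0 : ℝ) 1 := by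
  induction k with
  | zero => exact ⟨0, fun _ => ⟨0, by simp⟩, fun i hi => by simp at hi⟩
  | succ k ih =>
    obtain ⟨γ, hγ, h⟩ := ih
    by_cases hk : k < n
    · set m : ℤ := ⌊(γ + v + D.mul γ v) ⟨k, hk⟩⌋ with hm
      set δ : 𝔼 := EuclideanSpace.single ⟨k, hk⟩ (-(m : ℝ)) with hδ
      have hδi : ∀ i : Fin n, (i : ℕ) < k → δ i = 0 := fun i hi => by
        have : i ≠ ⟨k, hk⟩ := fun h => by rw [h] at hi; simp at hi
        simp [hδ, this]
      refine ⟨γ + δ, hγ.add fun i => ?_, fun i hi => ?_⟩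
      · by_cases hik : i = ⟨k, hk⟩
        · exact ⟨-m, by simp [hδ, hik]⟩
        · exact ⟨0, by simp [hδ, hik]⟩
      · have e : (γ + δ + v + D.mul (γ + δ) v) i = (γ + v + D.mul γ v) i + δ i := by
          have := D.mul_left_triangular k δ v hδi i (Nat.lt_succ_iff.mp hi)
          simp [this]; ring
        rw [e]
        rcases (Nat.lt_succ_iff.mp hi).lt_or_eq with hlt | heq
        · rw [hδi i hlt, add_zero]; exact h i hlt
        · have hik : i = ⟨k, hk⟩ := Fin.ext heq
          have : δ i = -(m : ℝ) := by simp [hδ, hik]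
          rw [this, hik, ← sub_eq_add_neg]
          exact ⟨Int.fract_nonneg _, (Int.fract_lt_one _).le⟩
    · exact ⟨γ, hγ, fun i hi => h i (by omega)⟩

theorem compactSpace_quotient :
    letI := D.group; CompactSpace (orbitRel.Quotient D.lattice 𝔼) := by
  let := D.group
  have hK : IsCompact (WithLp.toLp 2 '' Set.Icc (0 : Fin n → ℝ) 1 : Set 𝔼) :=
    isCompact_Icc.image (PiLp.continuous_toLp 2 _)
  have hc : Continuous (Quotient.mk _ : 𝔼 → orbitRel.Quotient D.lattice 𝔼) :=
    continuous_quotient_mk'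
  refine ⟨?_⟩
  convert hK.image hc
  refine (Set.eq_univ_of_forall fun q => ?_).symm
  obtain ⟨v, rfl⟩ := Quotient.mk_surjective q
  obtain ⟨γ, hγ, h⟩ := D.exists_integral_mul_mem_cube v n
  refine ⟨γ * v, ⟨(γ + v + D.mul γ v).ofLp, ⟨fun i => (h i i.2).1, fun i => (h i i.2).2⟩, rfl⟩, ?_⟩
  exact Quotient.sound ⟨⟨γ, hγ⟩, rfl⟩

/-- The nilmanifold `ℤⁿ \ (1 + A)`. -/
def nilmanifold : Nilmanifold n :=
  letI := D.group
  { G := 𝔼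
    group := D.group
    lieGroup := D.lieGroup
    simplyConnected := inferInstance
    nilpotent := D.isNilpotent
    Γ := D.lattice
    discrete := D.discreteTopology_lattice
    compact := D.compactSpace_quotient }


/-! ### Left multiplications and charts of the quotient -/

/-- The derivative `1 + L_x` of the left multiplication by `x`, which is an affine map; see
`hasFDerivAt_op`. -/
def leftDeriv (x : 𝔼) : 𝔼 →L[ℝ] 𝔼 := ContinuousLinearMap.id ℝ 𝔼 + D.mul x

theorem leftDeriv_apply (x v : 𝔼) : D.leftDeriv x v = v + D.mul x v := rfl

theorem inv_op (x : 𝔼) : D.op (D.inv x) x = 0 := D.group.inv_mul_cancel x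

theorem op_inv (x : 𝔼) : D.op x (D.inv x) = 0 := by
  let := D.group
  exact mul_inv_cancel x

theorem op_assoc (x y z : 𝔼) : D.op (D.op x y) z = D.op x (D.op y z) :=
  D.group.mul_assoc x y z

theorem op_zero (x : 𝔼) : D.op x 0 = x := D.group.mul_one x

theorem leftDeriv_op (x y : 𝔼) :
    D.leftDeriv (D.op x y) = (D.leftDeriv x).comp (D.leftDeriv y) := by
  ext1 v
  simp only [leftDeriv_apply, op, ContinuousLinearMap.comp_apply, map_add, add_apply, D.mul_assoc]
  abel

theorem leftDeriv_zero : D.leftDeriv 0 = ContinuousLinearMap.id ℝ 𝔼 := by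
  simp [leftDeriv]

theorem leftDeriv_comp_inv (x : 𝔼) :
    (D.leftDeriv x).comp (D.leftDeriv (D.inv x)) = ContinuousLinearMap.id ℝ 𝔼 := by
  rw [← leftDeriv_op, op_inv, leftDeriv_zero]

theorem leftDeriv_inv_comp (x : 𝔼) :
    (D.leftDeriv (D.inv x)).comp (D.leftDeriv x) = ContinuousLinearMap.id ℝ 𝔼 := by
  rw [← leftDeriv_op, inv_op, leftDeriv_zero]

@[simp] theorem leftDeriv_inv_apply (x v : 𝔼) :
    D.leftDeriv x (D.leftDeriv (D.inv x) v) = v :=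
  DFunLike.congr_fun (D.leftDeriv_comp_inv x) v

@[simp] theorem leftDeriv_inv_apply' (x v : 𝔼) :
    D.leftDeriv (D.inv x) (D.leftDeriv x v) = v :=
  DFunLike.congr_fun (D.leftDeriv_inv_comp x) v

theorem contDiff_leftDeriv : ContDiff ℝ ∞ D.leftDeriv :=
  contDiff_const.add D.mul.contDiff

theorem contDiff_inv : ContDiff ℝ ∞ D.inv := by
  have hA : ContDiff ℝ ∞ (fun x : 𝔼 => D.mul x) := D.mul.contDiff
  have h2 : ContDiff ℝ ∞ fun x : 𝔼 => D.mul x x := hA.clm_apply contDiff_id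
  exact (contDiff_neg.add h2).sub ((hA.comp h2).clm_apply contDiff_id)

theorem hasFDerivAt_op (x y : 𝔼) : HasFDerivAt (D.op x) (D.leftDeriv x) y := by
  have : HasFDerivAt (fun y => x + (D.leftDeriv x) y) (D.leftDeriv x) y :=
    (D.leftDeriv x).hasFDerivAt.const_add x
  convert! this using 1
  ext1 z
  simp only [op, leftDeriv_apply]
  abel

/-- The projection to the quotient, with the group seen as the vector space `ℝⁿ`. -/
abbrev proj : 𝔼 → D.nilmanifold.M := D.nilmanifold.proj

theorem continuous_proj : Continuous D.proj := continuous_quotient_mk'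

theorem chartAt_symm_apply (q : D.nilmanifold.M) (y : 𝔼) :
    (chartAt 𝔼 q).symm y = D.proj y := by
  change ((IsLocalHomeomorph.localInverseAt _ _).trans (chartAt 𝔼 _)).symm y = _
  simp
  rfl

theorem proj_chartAt {q p : D.nilmanifold.M} (hp : p ∈ (chartAt 𝔼 q).source) :
    D.proj (chartAt 𝔼 q p) = p := by
  rw [← D.chartAt_symm_apply q, (chartAt 𝔼 q).left_inv hp]

/-- If `x` and `y` have the same image in the quotient, then `x y⁻¹` lies in the lattice. -/
theorem proj_op_of_proj_eq {x y : 𝔼} (h : D.proj x = D.proj y) (z : 𝔼) :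
    D.proj (D.op (D.op x (D.inv y)) z) = D.proj z := by
  let := D.group
  obtain ⟨⟨γ, hγΓ⟩, hγ⟩ := Quotient.exact h
  change 𝔼 at γ
  have hγ' : γ * y = x := hγ
  have : γ = x * y⁻¹ := by rw [← hγ']; group
  change D.proj (x * y⁻¹ * z) = _
  rw [← this]
  exact Quotient.sound ⟨⟨γ, hγΓ⟩, rfl⟩

/-- Read on the group, the charts of the quotient are locally left multiplications by elements of
the lattice. -/
theorem chartAt_proj_eventuallyEq {q : D.nilmanifold.M} {y : 𝔼}
    (hy : D.proj y ∈ (chartAt 𝔼 q).source) :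
    (fun z => chartAt 𝔼 q (D.proj z)) =ᶠ[𝓝 y]
      D.op (D.op (chartAt 𝔼 q (D.proj y)) (D.inv y)) := by
  have h := D.proj_chartAt hy
  set x := chartAt 𝔼 q (D.proj y) with hx
  have hxt : x ∈ (chartAt 𝔼 q).target := (chartAt 𝔼 q).map_source hy
  have hxy : D.op (D.op x (D.inv y)) y = x := by
    rw [op_assoc, inv_op, op_zero]
  have hc : ContinuousAt (D.op (D.op x (D.inv y))) y := (D.hasFDerivAt_op _ y).continuousAt
  have : ∀ᶠ z in 𝓝 y, D.op (D.op x (D.inv y)) z ∈ (chartAt 𝔼 q).target :=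
    hc ((chartAt 𝔼 q).open_target.mem_nhds (by rw [hxy]; exact hxt))
  filter_upwards [this] with z hz
  rw [← D.proj_op_of_proj_eq h z, ← D.chartAt_symm_apply q, (chartAt 𝔼 q).right_inv hz]

theorem hasFDerivAt_chartAt_proj {q : D.nilmanifold.M} {y : 𝔼}
    (hy : D.proj y ∈ (chartAt 𝔼 q).source) :
    HasFDerivAt (fun z => chartAt 𝔼 q (D.proj z))
      ((D.leftDeriv (chartAt 𝔼 q (D.proj y))).comp (D.leftDeriv (D.inv y))) y := by
  rw [← leftDeriv_op]
  exact (D.hasFDerivAt_op _ y).congr_of_eventuallyEq (D.chartAt_proj_eventuallyEq hy)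

/-- A point of the group above `q`: the value at `q` of the preferred chart at `q`. As tangent spaces
are identified with `ℝⁿ` by the preferred charts, a left-invariant vector field on the quotient is
`q ↦ leftDeriv (rep q) v`. -/
def rep (q : D.nilmanifold.M) : 𝔼 := chartAt 𝔼 q q

theorem proj_rep (q : D.nilmanifold.M) : D.proj (D.rep q) = q :=
  D.proj_chartAt (mem_chart_source 𝔼 q)

/-- The coordinate changes of the tangent bundle of the quotient. -/
theorem tangentCoordChange_eq {p q r : D.nilmanifold.M} (hp : r ∈ (chartAt 𝔼 p).source)
    (hq : r ∈ (chartAt 𝔼 q).source) :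
    tangentCoordChange (𝓡 n) p q r =
      (D.leftDeriv (chartAt 𝔼 q r)).comp (D.leftDeriv (D.inv (chartAt 𝔼 p r))) := by
  have h1 : D.proj (chartAt 𝔼 p r) = r := D.proj_chartAt hp
  have h := D.hasFDerivAt_chartAt_proj (q := q) (y := chartAt 𝔼 p r) (by rwa [h1])
  rw [h1] at h
  rw [tangentCoordChange_def]
  simp only [modelWithCornersSelf_coe, Set.range_id, fderivWithin_univ]
  rw [← h.fderiv]
  congr 1
  ext1 z
  simp [D.chartAt_symm_apply]

theorem contMDiff_proj : ContMDiff (𝓡 n) (𝓡 n) ∞ D.proj := by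
  intro y
  rw [contMDiffAt_iff_target]
  refine ⟨D.continuous_proj.continuousAt, ?_⟩
  have h := D.chartAt_proj_eventuallyEq (mem_chart_source 𝔼 (D.proj y))
  have h2 : ContDiff ℝ ∞ (D.op (D.op (chartAt 𝔼 (D.proj y) (D.proj y)) (D.inv y))) := by
    have := fun z => (D.hasFDerivAt_op (D.op (chartAt 𝔼 (D.proj y) (D.proj y)) (D.inv y)) z)
    change ContDiff ℝ ∞ fun z => _ + z + D.mul _ z
    exact (contDiff_const.add contDiff_id).add (ContinuousLinearMap.contDiff _)
  have h3 : ContDiffAt ℝ ∞ (fun z => chartAt 𝔼 (D.proj y) (D.proj z)) y :=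
    h2.contDiffAt.congr_of_eventuallyEq h
  have h4 := h3.contMDiffAt
  convert! h4 using 1

theorem mfderiv_proj (y : 𝔼) : mfderiv (𝓡 n) (𝓡 n) D.proj y =
    (D.leftDeriv (D.rep (D.proj y))).comp (D.leftDeriv (D.inv y)) := by
  have hd : MDifferentiableAt (𝓡 n) (𝓡 n) D.proj y :=
    (D.contMDiff_proj y).mdifferentiableAt (by simp)
  have h := D.hasFDerivAt_chartAt_proj (mem_chart_source 𝔼 (D.proj y))
  refine hd.mfderiv.trans (Eq.trans ?_ h.fderiv)
  simp only [modelWithCornersSelf_coe, Set.range_id, fderivWithin_univ]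
  rfl


/-! ### Left-invariant almost complex structures -/

/-- The left-invariant field of endomorphisms of the group with value `j` at the identity. -/
def conjEnd (j : 𝔼 →L[ℝ] 𝔼) (y : 𝔼) : 𝔼 →L[ℝ] 𝔼 :=
  (D.leftDeriv y).comp (j.comp (D.leftDeriv (D.inv y)))

theorem conjEnd_apply (j : 𝔼 →L[ℝ] 𝔼) (y v : 𝔼) :
    D.conjEnd j y v = D.leftDeriv y (j (D.leftDeriv (D.inv y) v)) := rfl

theorem contDiff_conjEnd (j : 𝔼 →L[ℝ] 𝔼) : ContDiff ℝ ∞ (D.conjEnd j) :=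
  D.contDiff_leftDeriv.clm_comp
    (contDiff_const.clm_comp (D.contDiff_leftDeriv.comp D.contDiff_inv))

theorem contMDiffAt_comp_chartAt {F : Type*} [NormedAddCommGroup F] [NormedSpace ℝ F]
    {f : 𝔼 → F} (hf : ContDiff ℝ ∞ f) (q : D.nilmanifold.M) :
    ContMDiffAt (𝓡 n) 𝓘(ℝ, F) ∞ (fun p => f (chartAt 𝔼 q p)) q := by
  have h1 : ContMDiffAt (𝓡 n) 𝓘(ℝ, 𝔼) ∞ (chartAt 𝔼 q) q :=
    (contMDiffOn_chart (I := 𝓡 n) (n := ∞) (x := q)).contMDiffAt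
      ((chartAt 𝔼 q).open_source.mem_nhds (mem_chart_source 𝔼 q))
  exact hf.contMDiff.contMDiffAt.comp q h1

/-- Left-invariant vector fields on the quotient are smooth. -/
theorem contMDiff_frame (v : 𝔼) : ContMDiff (𝓡 n) (𝓡 n).tangent ∞
    (fun q => (⟨q, D.leftDeriv (D.rep q) v⟩ : TangentBundle (𝓡 n) D.nilmanifold.M)) := by
  intro q
  rw [Bundle.contMDiffAt_totalSpace]
  refine ⟨contMDiffAt_id, ?_⟩
  have h := D.contMDiffAt_comp_chartAt (f := fun y => D.leftDeriv y v)
    (D.contDiff_leftDeriv.clm_apply contDiff_const) q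
  refine h.congr_of_eventuallyEq ?_
  filter_upwards [(chartAt 𝔼 q).open_source.mem_nhds (mem_chart_source 𝔼 q)] with p hp
  have h1 : tangentCoordChange (𝓡 n) p q p =
      (D.leftDeriv (chartAt 𝔼 q p)).comp (D.leftDeriv (D.inv (D.rep p))) :=
    D.tangentCoordChange_eq (mem_chart_source 𝔼 p) hp
  have h2 : tangentCoordChange (𝓡 n) p q p (D.leftDeriv (D.rep p) v) =
      D.leftDeriv (chartAt 𝔼 q p) v := by
    rw [h1, ContinuousLinearMap.comp_apply, leftDeriv_inv_apply']
  exact h2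

/-- The value of the left-invariant field at `y`, moved to `x` by a left multiplication, is its
value at `x`. -/
theorem conjEnd_comp (j : 𝔼 →L[ℝ] 𝔼) (x y : 𝔼) :
    ((D.leftDeriv x).comp (D.leftDeriv (D.inv y))).comp ((D.conjEnd j y).comp
      ((D.leftDeriv y).comp (D.leftDeriv (D.inv x)))) = D.conjEnd j x := by
  ext1 v
  simp [conjEnd_apply]

/-- The left-invariant almost complex structure on the quotient defined by `j`. -/
def leftInvariant (j : 𝔼 →L[ℝ] 𝔼) (hj : ∀ v, j (j v) = -v) :
    AlmostComplexStructure n D.nilmanifold.M where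
  toFun q := D.conjEnd j (D.rep q)
  smooth := by
    intro q
    rw [contMDiffAt_hom_bundle]
    refine ⟨contMDiffAt_id, ?_⟩
    refine (D.contMDiffAt_comp_chartAt (D.contDiff_conjEnd j) q).congr_of_eventuallyEq ?_
    filter_upwards [(chartAt 𝔼 q).open_source.mem_nhds (mem_chart_source 𝔼 q)] with p hp
    refine (inTangentCoordinates_eq (I := 𝓡 n) (I' := 𝓡 n) (fun p : D.nilmanifold.M => p)
      (fun p : D.nilmanifold.M => p) (fun p => D.conjEnd j (D.rep p)) (x₀ := q) hp hp).trans ?_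
    have h1 := D.tangentCoordChange_eq (mem_chart_source 𝔼 p) hp
    have h2 := D.tangentCoordChange_eq hp (mem_chart_source 𝔼 p)
    refine Eq.trans ?_ (D.conjEnd_comp j (chartAt 𝔼 q p) (D.rep p))
    exact congrArg₂ (fun a b => ContinuousLinearMap.comp a ((D.conjEnd j (D.rep p)).comp b)) h1 h2
  sq_eq_neg q v := by
    change D.conjEnd j (D.rep q) (D.conjEnd j (D.rep q) v) = -v
    have h : ∀ v : 𝔼, D.conjEnd j (D.rep q) (D.conjEnd j (D.rep q) v) = -v := fun v => by
      simp [conjEnd_apply, hj]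
    exact h v

theorem isLeftInvariant_leftInvariant (j : 𝔼 →L[ℝ] 𝔼) (hj : ∀ v, j (j v) = -v) :
    D.nilmanifold.IsLeftInvariant (D.leftInvariant j hj) := by
  refine ⟨fun g => D.conjEnd j g, fun g v => ?_, fun h g v => ?_⟩
  · have := D.mfderiv_proj g
    have e : ∀ w : 𝔼, mfderiv (𝓡 n) (𝓡 n) D.nilmanifold.proj g w =
      (D.leftDeriv (D.rep (D.proj g))).comp (D.leftDeriv (D.inv g)) w :=
      fun w => DFunLike.congr_fun this w
    have main : ∀ g v : 𝔼, (D.leftDeriv (D.rep (D.proj g))).comp (D.leftDeriv (D.inv g))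
        (D.conjEnd j g v) = D.conjEnd j (D.rep (D.proj g))
          ((D.leftDeriv (D.rep (D.proj g))).comp (D.leftDeriv (D.inv g)) v) := fun g v => by
      simp [conjEnd_apply]
    exact (e _).trans ((main g v).trans
      (congrArg (D.conjEnd j (D.rep (D.proj g))) (e v).symm))
  · change 𝔼 at h g v
    have e : ∀ w : 𝔼, mfderiv (𝓡 n) (𝓡 n) (D.op h) g w = D.leftDeriv h w := fun w => by
      rw [mfderiv_eq_fderiv, (D.hasFDerivAt_op h g).fderiv]
      rfl
    have this : ∀ u, D.leftDeriv (D.inv (D.op h g)) (D.leftDeriv h u) = D.leftDeriv (D.inv g) u := by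
      intro u
      have hu : D.leftDeriv h u = D.leftDeriv (D.op h g) (D.leftDeriv (D.inv g) u) := by
        rw [leftDeriv_op]; simp
      rw [hu, leftDeriv_inv_apply']
    have main : D.leftDeriv h (D.conjEnd j g v) =
        D.conjEnd j (D.op h g) (D.leftDeriv h v) := by
      rw [conjEnd_apply, conjEnd_apply, this, leftDeriv_op]
      rfl
    exact (e _).trans (main.trans (congrArg (D.conjEnd j (D.op h g)) (e v).symm))

theorem mfderiv_chartAt_symm (q : D.nilmanifold.M) (y : 𝔼) :
    mfderiv (𝓡 n) (𝓡 n) (chartAt 𝔼 q).symm y =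
      (D.leftDeriv (D.rep (D.proj y))).comp (D.leftDeriv (D.inv y)) := by
  rw [← mfderiv_proj]
  have : ((chartAt 𝔼 q).symm : 𝔼 → D.nilmanifold.M) = D.proj :=
    funext fun z => D.chartAt_symm_apply q z
  rw [this]

/-- In every chart, the almost complex structure on the quotient is given by the left-invariant
field on the group. -/
theorem localRep_leftInvariant (j : 𝔼 →L[ℝ] 𝔼) (hj : ∀ v, j (j v) = -v)
    {q : D.nilmanifold.M} {y : 𝔼} (hy : y ∈ (chartAt 𝔼 q).target) :
    (D.leftInvariant j hj).localRep q y = D.conjEnd j y := by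
  have h1 : (chartAt 𝔼 q).symm y = D.proj y := D.chartAt_symm_apply q y
  have h2 : D.proj y ∈ (chartAt 𝔼 q).source := h1 ▸ (chartAt 𝔼 q).map_target hy
  have h3 : mfderiv (𝓡 n) (𝓡 n) (chartAt 𝔼 q) (D.proj y) =
      (D.leftDeriv y).comp (D.leftDeriv (D.inv (D.rep (D.proj y)))) := by
    refine (mfderiv_chartAt_eq_tangentCoordChange (I := 𝓡 n) h2).trans ?_
    rw [D.tangentCoordChange_eq (mem_chart_source 𝔼 _) h2, ← h1, (chartAt 𝔼 q).right_inv hy]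
    rfl
  have h4 := D.mfderiv_chartAt_symm q y
  refine Eq.trans ?_ (D.conjEnd_comp j y (D.rep (D.proj y)))
  unfold AlmostComplexStructure.localRep
  rw [h4]
  generalize (chartAt 𝔼 q).symm y = r at h1
  subst h1
  exact congrArg (fun a => ContinuousLinearMap.comp a _) h3


/-! ### Continuity in the smooth topology -/

/-- The field `conjEnd j` as a linear function of `j`. -/
def conjOp (y : 𝔼) : (𝔼 →L[ℝ] 𝔼) →L[ℝ] (𝔼 →L[ℝ] 𝔼) :=
  (ContinuousLinearMap.compL ℝ 𝔼 𝔼 𝔼 (D.leftDeriv y)).comp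
    ((ContinuousLinearMap.compL ℝ 𝔼 𝔼 𝔼).flip (D.leftDeriv (D.inv y)))

theorem contDiff_conjOp : ContDiff ℝ ∞ D.conjOp := by
  refine ContDiff.clm_comp ?_ ?_
  · exact (ContinuousLinearMap.contDiff _).comp D.contDiff_leftDeriv
  · exact (ContinuousLinearMap.contDiff _).comp (D.contDiff_leftDeriv.comp D.contDiff_inv)

theorem iteratedFDeriv_conjEnd (m : ℕ) (j : 𝔼 →L[ℝ] 𝔼) (y : 𝔼) :
    iteratedFDeriv ℝ m (D.conjEnd j) y =
      (ContinuousLinearMap.apply ℝ (𝔼 →L[ℝ] 𝔼) j).compContinuousMultilinearMap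
        (iteratedFDeriv ℝ m D.conjOp y) :=
  (ContinuousLinearMap.apply ℝ (𝔼 →L[ℝ] 𝔼) j).iteratedFDeriv_comp_left
    D.contDiff_conjOp.contDiffAt (by exact_mod_cast le_top)

theorem continuous_iteratedFDeriv_conjEnd (m : ℕ) : Continuous
    fun p : (𝔼 →L[ℝ] 𝔼) × 𝔼 => iteratedFDeriv ℝ m (D.conjEnd p.1) p.2 := by
  simp_rw [iteratedFDeriv_conjEnd]
  have h1 : Continuous fun p : (𝔼 →L[ℝ] 𝔼) × 𝔼 => iteratedFDeriv ℝ m D.conjOp p.2 :=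
    (D.contDiff_conjOp.continuous_iteratedFDeriv (by exact_mod_cast le_top)).comp continuous_snd
  have h2 : Continuous fun p : (𝔼 →L[ℝ] 𝔼) × 𝔼 =>
      ContinuousLinearMap.apply ℝ (𝔼 →L[ℝ] 𝔼) p.1 :=
    (ContinuousLinearMap.continuous _).comp continuous_fst
  exact (isBoundedBilinearMap_compMultilinear (𝕜 := ℝ) (E := fun _ : Fin m => 𝔼)).continuous.comp
    (h2.prodMk h1)

/-- The left-invariant structure depends continuously on `j`: the derivatives of the local
expressions are jointly continuous in `j` and in the point, hence converge uniformly on compact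
sets. -/
theorem continuous_leftInvariant :
    Continuous fun j : {j : 𝔼 →L[ℝ] 𝔼 // ∀ v, j (j v) = -v} => D.leftInvariant j.1 j.2 := by
  refine continuous_iInf_rng.mpr fun q => continuous_iInf_rng.mpr fun m =>
    continuous_induced_rng.mpr ?_
  rw [continuous_iff_continuousAt]
  intro j₀
  refine UniformOnFun.tendsto_iff_tendstoUniformlyOn.mpr ?_
  rintro K ⟨hK, hKt⟩
  have e : ∀ j : {j : 𝔼 →L[ℝ] 𝔼 // ∀ v, j (j v) = -v}, ∀ y ∈ K,
      iteratedFDeriv ℝ m (D.conjEnd j.1) y =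
        iteratedFDeriv ℝ m ((D.leftInvariant j.1 j.2).localRep q) y := fun j y hy => by
    refine Filter.EventuallyEq.eq_of_nhds (Filter.EventuallyEq.iteratedFDeriv ℝ ?_ m)
    filter_upwards [(chartAt 𝔼 q).open_target.mem_nhds (hKt hy)] with z hz
    exact (D.localRep_leftInvariant j.1 j.2 hz).symm
  have hc : Continuous fun p : {j : 𝔼 →L[ℝ] 𝔼 // ∀ v, j (j v) = -v} × 𝔼 =>
      iteratedFDeriv ℝ m (D.conjEnd p.1.1) p.2 :=
    (D.continuous_iteratedFDeriv_conjEnd m).comp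
      ((continuous_subtype_val.comp continuous_fst).prodMk continuous_snd)
  intro u hu
  obtain ⟨v, hv, h⟩ := hK.mem_uniformity_of_prod
    (f := fun (j : {j : 𝔼 →L[ℝ] 𝔼 // ∀ v, j (j v) = -v}) y => iteratedFDeriv ℝ m (D.conjEnd j.1) y)
    (s := Set.univ) hc.continuousOn (Set.mem_univ j₀) (symm_le_uniformity hu)
  rw [nhdsWithin_univ] at hv
  filter_upwards [hv] with j hj y hy
  have := h j hj y hy
  rw [e j y hy, e j₀ y hy] at this
  exact this

/-! ### The Nijenhuis tensor in the left-invariant frame -/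

/-- The commutator of `A`, which is the Lie bracket of the Lie algebra of `1 + A`. -/
def bracket (v w : 𝔼) : 𝔼 := D.mul v w - D.mul w v

/-- The Nijenhuis tensor of the linear complex structure `j` on the Lie algebra of `1 + A`. -/
def linearNijenhuis (j : 𝔼 →L[ℝ] 𝔼) (v w : 𝔼) : 𝔼 :=
  D.bracket (j v) (j w) - j (D.bracket (j v) w) - j (D.bracket v (j w)) - D.bracket v w

/-- The components of a vector field on the quotient in the left-invariant frame. -/
def coord (V : ∀ q : D.nilmanifold.M, TangentSpace (𝓡 n) q) (q : D.nilmanifold.M) : 𝔼 :=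
  D.leftDeriv (D.inv (D.rep q)) (V q)

variable {D}

/-- The pullback to the group of a vector field has the same components as the field. -/
theorem mpullback_proj_apply (V : ∀ q : D.nilmanifold.M, TangentSpace (𝓡 n) q) (y : 𝔼) :
    VectorField.mpullback (𝓡 n) (𝓡 n) D.proj V y = D.leftDeriv y (D.coord V (D.proj y)) := by
  rw [VectorField.mpullback_apply]
  have h1 : ((D.leftDeriv (D.rep (D.proj y))).comp (D.leftDeriv (D.inv y))).comp
      ((D.leftDeriv y).comp (D.leftDeriv (D.inv (D.rep (D.proj y))))) =
        ContinuousLinearMap.id ℝ 𝔼 := by ext1 v; simp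
  have h2 : ((D.leftDeriv y).comp (D.leftDeriv (D.inv (D.rep (D.proj y))))).comp
      ((D.leftDeriv (D.rep (D.proj y))).comp (D.leftDeriv (D.inv y))) =
        ContinuousLinearMap.id ℝ 𝔼 := by ext1 v; simp
  have h3 := ContinuousLinearMap.inverse_eq h1 h2
  have h4 := D.mfderiv_proj y
  have h5 : (mfderiv (𝓡 n) (𝓡 n) D.proj y).inverse =
      (D.leftDeriv y).comp (D.leftDeriv (D.inv (D.rep (D.proj y)))) :=
    (congrArg ContinuousLinearMap.inverse h4).trans h3
  exact DFunLike.congr_fun h5 (V (D.proj y))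

theorem isInvertible_mfderiv_proj (y : 𝔼) : (mfderiv (𝓡 n) (𝓡 n) D.proj y).IsInvertible := by
  have h4 := D.mfderiv_proj y
  have : ((D.leftDeriv (D.rep (D.proj y))).comp (D.leftDeriv (D.inv y))).IsInvertible :=
    ContinuousLinearMap.IsInvertible.of_inverse
      (g := (D.leftDeriv y).comp (D.leftDeriv (D.inv (D.rep (D.proj y)))))
      (by ext1 v; simp) (by ext1 v; simp)
  exact h4 ▸ this

theorem contDiff_leftDeriv_coord {V : ∀ q : D.nilmanifold.M, TangentSpace (𝓡 n) q}
    (hV : ContMDiff (𝓡 n) (𝓡 n).tangent ∞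
      (fun q => (⟨q, V q⟩ : TangentBundle (𝓡 n) D.nilmanifold.M))) :
    ContDiff ℝ ∞ fun y => D.leftDeriv y (D.coord V (D.proj y)) := by
  have h := ContMDiff.mpullback_vectorField hV D.contMDiff_proj isInvertible_mfderiv_proj
    (by simp)
  have h2 := contMDiff_vectorSpace_iff_contDiff.mp h
  have e : VectorField.mpullback (𝓡 n) (𝓡 n) D.proj V =
      fun y => D.leftDeriv y (D.coord V (D.proj y)) := funext fun y => mpullback_proj_apply V y
  rwa [e] at h2

theorem contDiff_coord {V : ∀ q : D.nilmanifold.M, TangentSpace (𝓡 n) q}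
    (hV : ContMDiff (𝓡 n) (𝓡 n).tangent ∞
      (fun q => (⟨q, V q⟩ : TangentBundle (𝓡 n) D.nilmanifold.M))) :
    ContDiff ℝ ∞ fun y => D.coord V (D.proj y) := by
  simpa using (D.contDiff_leftDeriv.comp D.contDiff_inv).clm_apply (contDiff_leftDeriv_coord hV)

/-- The Lie bracket of two vector fields on the group, in terms of their components `ξ`, `η` in the
left-invariant frame. -/
theorem lieBracket_leftDeriv {ξ η : 𝔼 → 𝔼} {y : 𝔼} (hξ : DifferentiableAt ℝ ξ y)
    (hη : DifferentiableAt ℝ η y) :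
    VectorField.lieBracket ℝ (fun z => D.leftDeriv z (ξ z)) (fun z => D.leftDeriv z (η z)) y =
      D.leftDeriv y (D.bracket (ξ y) (η y) + fderiv ℝ η y (D.leftDeriv y (ξ y))
        - fderiv ℝ ξ y (D.leftDeriv y (η y))) := by
  -- `x ↦ 1 + L_x` is affine, and associativity gives `L_{A v} w = A (L_v w)` for `A = 1 + L_y`.
  have hA : HasFDerivAt D.leftDeriv D.mul y := D.mul.hasFDerivAt.const_add _
  have key : ∀ {ζ : 𝔼 → 𝔼}, DifferentiableAt ℝ ζ y → ∀ v : 𝔼,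
      fderiv ℝ (fun z => D.leftDeriv z (ζ z)) y v =
        D.leftDeriv y (fderiv ℝ ζ y v) + D.mul v (ζ y) := fun hζ v => by
    rw [(hA.clm_apply hζ.hasFDerivAt).fderiv]
    simp
  rw [VectorField.lieBracket, key hξ, key hη]
  simp only [leftDeriv_apply, bracket, map_add, map_sub, add_apply, D.mul_assoc]
  abel

theorem two_le_infty : (2 : WithTop ℕ∞) ≤ ∞ :=
  WithTop.coe_le_coe.mpr (le_top : (2 : ℕ∞) ≤ ⊤)

theorem mlieBracket_eq_lieBracket (V W : 𝔼 → 𝔼) (y : 𝔼) :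
    VectorField.mlieBracket (𝓡 n) (M := 𝔼) V W y = VectorField.lieBracket ℝ V W y := by
  refine (congrFun VectorField.mlieBracketWithin_univ y).symm.trans
    ((congrFun VectorField.mlieBracketWithin_eq_lieBracketWithin y).trans ?_)
  exact congrFun VectorField.lieBracketWithin_univ y

/-- The Lie bracket of two vector fields on the quotient, in terms of their components in the
left-invariant frame: the bracket of `A` plus first order terms. -/
theorem coord_mlieBracket {V W : ∀ q : D.nilmanifold.M, TangentSpace (𝓡 n) q}
    (hV : ContMDiff (𝓡 n) (𝓡 n).tangent ∞
      (fun q => (⟨q, V q⟩ : TangentBundle (𝓡 n) D.nilmanifold.M)))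
    (hW : ContMDiff (𝓡 n) (𝓡 n).tangent ∞
      (fun q => (⟨q, W q⟩ : TangentBundle (𝓡 n) D.nilmanifold.M))) (y : 𝔼) :
    D.coord (VectorField.mlieBracket (𝓡 n) V W) (D.proj y) =
      D.bracket (D.coord V (D.proj y)) (D.coord W (D.proj y))
      + fderiv ℝ (fun z => D.coord W (D.proj z)) y (D.leftDeriv y (D.coord V (D.proj y)))
      - fderiv ℝ (fun z => D.coord V (D.proj z)) y (D.leftDeriv y (D.coord W (D.proj y))) := by
  have : IsManifold (𝓡 n) (minSmoothness ℝ 2) D.nilmanifold.M := by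
    rw [minSmoothness_of_isRCLikeNormedField]
    exact IsManifold.of_le (n := ∞) two_le_infty
  have h := VectorField.mpullback_mlieBracket (x₀ := y)
    ((hV (D.proj y)).mdifferentiableAt (by simp)) ((hW (D.proj y)).mdifferentiableAt (by simp))
    (D.contMDiff_proj y)
    (by rw [minSmoothness_of_isRCLikeNormedField]; exact two_le_infty)
  rw [mpullback_proj_apply] at h
  have e : ∀ U : ∀ q : D.nilmanifold.M, TangentSpace (𝓡 n) q,
    VectorField.mpullback (𝓡 n) (𝓡 n) D.proj U = fun y => D.leftDeriv y (D.coord U (D.proj y)) :=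
    fun U => funext fun y => mpullback_proj_apply U y
  rw [e V, e W] at h
  have h2 := lieBracket_leftDeriv (D := D)
    ((contDiff_coord hV).differentiable (by simp) y) ((contDiff_coord hW).differentiable (by simp) y)
  have h3 := congrArg (D.leftDeriv (D.inv y)) ((h.trans (mlieBracket_eq_lieBracket _ _ y)).trans h2)
  rwa [leftDeriv_inv_apply', leftDeriv_inv_apply'] at h3

theorem coord_applyField (j : 𝔼 →L[ℝ] 𝔼) (hj : ∀ v, j (j v) = -v)
    (V : ∀ q : D.nilmanifold.M, TangentSpace (𝓡 n) q) (q : D.nilmanifold.M) :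
    D.coord ((D.leftInvariant j hj).applyField V) q = j (D.coord V q) :=
  D.leftDeriv_inv_apply' (D.rep q) _

/-- The Nijenhuis tensor of a left-invariant structure is the algebraic one: the first order terms in
`coord_mlieBracket` cancel, as `j² = -1`. -/
theorem coord_nijenhuis (j : 𝔼 →L[ℝ] 𝔼) (hj : ∀ v, j (j v) = -v)
    {X Y : ∀ q : D.nilmanifold.M, TangentSpace (𝓡 n) q}
    (hX : ContMDiff (𝓡 n) (𝓡 n).tangent ∞
      (fun q => (⟨q, X q⟩ : TangentBundle (𝓡 n) D.nilmanifold.M)))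
    (hY : ContMDiff (𝓡 n) (𝓡 n).tangent ∞
      (fun q => (⟨q, Y q⟩ : TangentBundle (𝓡 n) D.nilmanifold.M))) (q : D.nilmanifold.M) :
    D.coord ((D.leftInvariant j hj).nijenhuis X Y) q =
      D.linearNijenhuis j (D.coord X q) (D.coord Y q) := by
  set J := D.leftInvariant j hj with hJ
  have hJX : ContMDiff (𝓡 n) (𝓡 n).tangent ∞
      (fun q => (⟨q, J.applyField X q⟩ : TangentBundle (𝓡 n) D.nilmanifold.M)) :=
    ContMDiff.clm_bundle_apply J.smooth hX
  have hJY : ContMDiff (𝓡 n) (𝓡 n).tangent ∞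
      (fun q => (⟨q, J.applyField Y q⟩ : TangentBundle (𝓡 n) D.nilmanifold.M)) :=
    ContMDiff.clm_bundle_apply J.smooth hY
  have e : D.coord (J.nijenhuis X Y) q =
      D.coord (VectorField.mlieBracket (𝓡 n) (J.applyField X) (J.applyField Y)) q
      - D.coord (J.applyField (VectorField.mlieBracket (𝓡 n) (J.applyField X) Y)) q
      - D.coord (J.applyField (VectorField.mlieBracket (𝓡 n) X (J.applyField Y))) q
      - D.coord (VectorField.mlieBracket (𝓡 n) X Y) q := by
    have h : ∀ a b c d : 𝔼, D.leftDeriv (D.inv (D.rep q)) (a - b - c - d) =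
      D.leftDeriv (D.inv (D.rep q)) a - D.leftDeriv (D.inv (D.rep q)) b -
      D.leftDeriv (D.inv (D.rep q)) c - D.leftDeriv (D.inv (D.rep q)) d := by
      intro a b c d; simp only [map_sub]
    exact h _ _ _ _
  rw [e, coord_applyField, coord_applyField]
  obtain ⟨y, rfl⟩ : ∃ y, D.proj y = q := ⟨_, D.proj_rep q⟩
  rw [coord_mlieBracket hJX hJY, coord_mlieBracket hJX hY, coord_mlieBracket hX hJY,
    coord_mlieBracket hX hY]
  have hdX : (fun z => D.coord (J.applyField X) (D.proj z)) =
      fun z => j (D.coord X (D.proj z)) := funext fun z => coord_applyField j hj X _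
  have hdY : (fun z => D.coord (J.applyField Y) (D.proj z)) =
      fun z => j (D.coord Y (D.proj z)) := funext fun z => coord_applyField j hj Y _
  have hd : ∀ {V : ∀ q : D.nilmanifold.M, TangentSpace (𝓡 n) q}, ContMDiff (𝓡 n) (𝓡 n).tangent ∞
      (fun q => (⟨q, V q⟩ : TangentBundle (𝓡 n) D.nilmanifold.M)) → ∀ v : 𝔼,
      fderiv ℝ (fun z => j (D.coord V (D.proj z))) y v =
        j (fderiv ℝ (fun z => D.coord V (D.proj z)) y v) := fun hV v => by
    have := j.hasFDerivAt.comp y ((contDiff_coord hV).differentiable (by simp) y).hasFDerivAt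
    have h2 := this.fderiv
    exact DFunLike.congr_fun h2 v
  rw [hdX, hdY, hd hX, hd hY]
  simp only [hd hX, hd hY, coord_applyField j hj, hJ, linearNijenhuis, map_add, map_sub, hj]
  abel

/-- The real span of the values of the algebraic Nijenhuis tensor. -/
def linearNijenhuisImage (D : NilpotentAlgebra n) (j : 𝔼 →L[ℝ] 𝔼) : Submodule ℝ 𝔼 :=
  Submodule.span ℝ {v | ∃ x y, D.linearNijenhuis j x y = v}

theorem hasRank_leftInvariant (j : 𝔼 →L[ℝ] 𝔼) (hj : ∀ v, j (j v) = -v) {k : ℕ}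
    (hk : Module.finrank ℝ (D.linearNijenhuisImage j) = 2 * k) :
    (D.leftInvariant j hj).HasRank k := by
  intro q
  rw [← hk]
  let e : 𝔼 ≃ₗ[ℝ] 𝔼 := LinearEquiv.ofLinearMap (D.leftDeriv (D.rep q)).toLinearMap
    (D.leftDeriv (D.inv (D.rep q))).toLinearMap (by ext1 v; simp) (by ext1 v; simp)
  have hmap : (D.linearNijenhuisImage j).map (e : 𝔼 →ₗ[ℝ] 𝔼) =
      (D.leftInvariant j hj).nijenhuisImage q := by
    rw [linearNijenhuisImage, Submodule.map_span]
    refine congrArg (Submodule.span ℝ) (Set.ext fun v => ⟨?_, ?_⟩)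
    · rintro ⟨_, ⟨x, y, rfl⟩, rfl⟩
      refine ⟨fun p => D.leftDeriv (D.rep p) x, fun p => D.leftDeriv (D.rep p) y,
        D.contMDiff_frame x, D.contMDiff_frame y, ?_⟩
      have h := coord_nijenhuis j hj (D.contMDiff_frame x) (D.contMDiff_frame y) q
      have hx : ∀ x : 𝔼, D.coord (fun p => D.leftDeriv (D.rep p) x) q = x :=
        fun x => D.leftDeriv_inv_apply' _ _
      rw [hx, hx] at h
      have h2 := congrArg (D.leftDeriv (D.rep q)) h
      exact (D.leftDeriv_inv_apply _ _).symm.trans h2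
    · rintro ⟨X, Y, hX, hY, rfl⟩
      have h := coord_nijenhuis j hj hX hY q
      refine ⟨_, ⟨_, _, h.symm⟩, ?_⟩
      exact D.leftDeriv_inv_apply (D.rep q) _
  have h := LinearEquiv.finrank_map_eq e (D.linearNijenhuisImage j)
  rw [hmap] at h
  exact h


/-! ### Computation of ranks and paths of structures -/

/-- A criterion for the rank: if the algebraic Nijenhuis tensor takes values in the span of the
vectors `d i • f i`, with `f` linearly independent, and takes a nonzero multiple of each `d i • f i`
as a value, then its image has for dimension the number of nonzero `d i`. -/
theorem finrank_linearNijenhuisImage {n : ℕ} (D : NilpotentAlgebra n)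
    (j : EuclideanSpace ℝ (Fin n) →L[ℝ] EuclideanSpace ℝ (Fin n))
    {ι : Type*} [Fintype ι] {f : ι → EuclideanSpace ℝ (Fin n)} (hf : LinearIndependent ℝ f)
    (d : ι → ℝ) (c : EuclideanSpace ℝ (Fin n) → EuclideanSpace ℝ (Fin n) → ι → ℝ)
    (hc : ∀ x y, D.linearNijenhuis j x y = ∑ i, (c x y i * d i) • f i)
    (e : ι → ℝ) (he : ∀ i, e i ≠ 0) (x y : ι → EuclideanSpace ℝ (Fin n))
    (hxy : ∀ i, D.linearNijenhuis j (x i) (y i) = (e i * d i) • f i) :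
    Module.finrank ℝ (D.linearNijenhuisImage j) = ∑ i, if d i = 0 then 0 else 1 := by
  classical
  have hspan : D.linearNijenhuisImage j =
      Submodule.span ℝ (Set.range fun i : {i // d i ≠ 0} => f i) := by
    apply le_antisymm
    · refine Submodule.span_le.mpr ?_
      rintro _ ⟨v, w, rfl⟩
      rw [hc, SetLike.mem_coe]
      refine Submodule.sum_mem _ fun i _ => ?_
      by_cases hi : d i = 0
      · simp [hi]
      · exact Submodule.smul_mem _ _ (Submodule.subset_span ⟨⟨i, hi⟩, rfl⟩)
    · refine Submodule.span_le.mpr ?_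
      rintro _ ⟨⟨i, hi⟩, rfl⟩
      have h : f i = (e i * d i)⁻¹ • D.linearNijenhuis j (x i) (y i) := by
        rw [hxy, smul_smul, inv_mul_cancel₀ (mul_ne_zero (he i) hi), one_smul]
      change f i ∈ _
      rw [h]
      exact Submodule.smul_mem _ _ (Submodule.subset_span ⟨_, _, rfl⟩)
  rw [hspan]
  refine (finrank_span_eq_card (hf.comp _ Subtype.val_injective)).trans ?_
  rw [Fintype.card_subtype, Finset.card_filter]
  simp

theorem exists_leftInvariant_of_path {n : ℕ} (D : NilpotentAlgebra n)
    {j : ℝ → EuclideanSpace ℝ (Fin n) →L[ℝ] EuclideanSpace ℝ (Fin n)} (hc : Continuous j)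
    (hj : ∀ t v, j t (j t v) = -v) {k₀ k₁ : ℕ}
    (h₀ : Module.finrank ℝ (D.linearNijenhuisImage (j 0)) = 2 * k₀)
    (h₁ : ∀ t, t ≠ 0 → Module.finrank ℝ (D.linearNijenhuisImage (j t)) = 2 * k₁) :
    ∃ (N : Nilmanifold n) (J₀ : AlmostComplexStructure n N.M),
      N.IsLeftInvariant J₀ ∧ J₀.HasRank k₀ ∧
        ∀ U ∈ 𝓝 J₀, ∃ J ∈ U, N.IsLeftInvariant J ∧ J.HasRank k₁ := by
  refine ⟨D.nilmanifold, D.leftInvariant (j 0) (hj 0), D.isLeftInvariant_leftInvariant _ _,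
    hasRank_leftInvariant _ _ h₀, fun U hU => ?_⟩
  have hJ : Continuous fun t => D.leftInvariant (j t) (hj t) :=
    D.continuous_leftInvariant.comp (hc.subtype_mk hj)
  have hev : ∀ᶠ t in 𝓝[≠] (0 : ℝ), D.leftInvariant (j t) (hj t) ∈ U :=
    nhdsWithin_le_nhds (hJ.continuousAt.preimage_mem_nhds hU)
  obtain ⟨t, htU, ht⟩ := (hev.and self_mem_nhdsWithin).exists
  exact ⟨_, htU, D.isLeftInvariant_leftInvariant _ _, hasRank_leftInvariant _ _ (h₁ t ht)⟩

end NilpotentAlgebra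

namespace NilpotentAlgebra

local notation "𝔼" => EuclideanSpace ℝ (Fin 6)

/-! ### Two families of algebras of dimension six -/

/-- A bilinear map on `ℝ⁶` as a continuous one. -/
def bilinear (f : 𝔼 →ₗ[ℝ] 𝔼 →ₗ[ℝ] 𝔼) : 𝔼 →L[ℝ] 𝔼 →L[ℝ] 𝔼 :=
  LinearMap.toContinuousLinearMap
    ((LinearMap.toContinuousLinearMap : (𝔼 →ₗ[ℝ] 𝔼) ≃ₗ[ℝ] (𝔼 →L[ℝ] 𝔼)).toLinearMap ∘ₗ f)

theorem bilinear_apply (f : 𝔼 →ₗ[ℝ] 𝔼 →ₗ[ℝ] 𝔼) (x y : 𝔼) : bilinear f x y = f x y := rfl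

/-- The algebra with products `e₀ e₂ = a e₃`, `e₁ e₂ = b e₄`, `e₀ e₁ = c e₅`. -/
def twoStep (a b c : ℤ) : NilpotentAlgebra 6 where
  mul := bilinear (LinearMap.mk₂ ℝ
    (fun x y => !₂[0, 0, 0, a * (x 0 * y 2), b * (x 1 * y 2), c * (x 0 * y 1)])
    (fun x x' y => by ext i; fin_cases i <;> simp <;> ring)
    (fun r x y => by ext i; fin_cases i <;> simp <;> ring)
    (fun x y y' => by ext i; fin_cases i <;> simp <;> ring)
    (fun r x y => by ext i; fin_cases i <;> simp <;> ring))
  mul_assoc x y z := by ext i; fin_cases i <;> simp [bilinear_apply]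
  mul_mul_mul_eq_zero x y z w := by ext i; fin_cases i <;> simp [bilinear_apply]
  mul_left_triangular m x y h i hi := by
    fin_cases i <;> simp [bilinear_apply] at hi ⊢
    · simp [h 0 (by simp; omega)]
    · simp [h 1 (by simp; omega)]
    · simp [h 0 (by simp; omega)]
  mul_right_triangular m x y h i hi := by
    fin_cases i <;> simp [bilinear_apply] at hi ⊢
    · simp [h 2 (by simp; omega)]
    · simp [h 2 (by simp; omega)]
    · simp [h 1 (by simp; omega)]
  mul_integral x y hx hy i := by
    choose u hu using hx
    choose v hv using hy
    refine ⟨![0, 0, 0, a * (u 0 * v 2), b * (u 1 * v 2), c * (u 0 * v 1)] i, ?_⟩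
    fin_cases i <;> simp [bilinear_apply, hu, hv]

theorem twoStep_bracket (a b c : ℤ) (x y : 𝔼) : (twoStep a b c).bracket x y =
    !₂[0, 0, 0, a * (x 0 * y 2 - y 0 * x 2), b * (x 1 * y 2 - y 1 * x 2),
      c * (x 0 * y 1 - y 0 * x 1)] := by
  ext i
  fin_cases i <;> simp [bracket, twoStep, bilinear_apply] <;> ring

/-- The strictly upper triangular `4 × 4` matrices, with
`(e₀, …, e₅) = (E₁₂, E₂₃, E₃₄, E₁₃, E₂₄, E₁₄)`. -/
def upperTriangular : NilpotentAlgebra 6 where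
  mul := bilinear (LinearMap.mk₂ ℝ
    (fun x y => !₂[0, 0, 0, x 0 * y 1, x 1 * y 2, x 0 * y 4 + x 3 * y 2])
    (fun x x' y => by ext i; fin_cases i <;> simp <;> ring)
    (fun r x y => by ext i; fin_cases i <;> simp <;> ring)
    (fun x y y' => by ext i; fin_cases i <;> simp <;> ring)
    (fun r x y => by ext i; fin_cases i <;> simp <;> ring))
  mul_assoc x y z := by ext i; fin_cases i <;> simp [bilinear_apply]; ring
  mul_mul_mul_eq_zero x y z w := by ext i; fin_cases i <;> simp [bilinear_apply]
  mul_left_triangular m x y h i hi := by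
    fin_cases i <;> simp [bilinear_apply] at hi ⊢
    · simp [h 0 (by simp; omega)]
    · simp [h 1 (by simp; omega)]
    · simp [h 0 (by simp; omega), h 3 (by simp; omega)]
  mul_right_triangular m x y h i hi := by
    fin_cases i <;> simp [bilinear_apply] at hi ⊢
    · simp [h 1 (by simp; omega)]
    · simp [h 2 (by simp; omega)]
    · simp [h 4 (by simp; omega), h 2 (by simp; omega)]
  mul_integral x y hx hy i := by
    choose u hu using hx
    choose v hv using hy
    refine ⟨![0, 0, 0, u 0 * v 1, u 1 * v 2, u 0 * v 4 + u 3 * v 2] i, ?_⟩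
    fin_cases i <;> simp [bilinear_apply, hu, hv]

theorem upperTriangular_bracket (x y : 𝔼) : upperTriangular.bracket x y =
    !₂[0, 0, 0, x 0 * y 1 - y 0 * x 1, x 1 * y 2 - y 1 * x 2,
      x 0 * y 4 + x 3 * y 2 - (y 0 * x 4 + y 3 * x 2)] := by
  ext i
  fin_cases i <;> simp [bracket, upperTriangular, bilinear_apply]

/-- The complex structure with `e₀ ↦ e₁`, `e₂ ↦ e₅`, `e₃ ↦ e₄ - t e₀`, `e₄ ↦ -e₃ + t e₁`. It
preserves the plane `⟨e₃, e₄⟩` if `t = 0`, and maps `⟨e₃, e₄, e₅⟩` to a complement if `t ≠ 0`. -/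
def twoStepPath (t : ℝ) : 𝔼 →L[ℝ] 𝔼 := LinearMap.toContinuousLinearMap
  { toFun := fun x => !₂[-x 1 - t * x 3, x 0 + t * x 4, -x 5, -x 4, x 3, x 2]
    map_add' := fun x y => by ext i; fin_cases i <;> simp <;> ring
    map_smul' := fun r x => by ext i; fin_cases i <;> simp <;> ring }

theorem twoStepPath_apply (t : ℝ) (x : 𝔼) :
    twoStepPath t x = !₂[-x 1 - t * x 3, x 0 + t * x 4, -x 5, -x 4, x 3, x 2] := rfl

theorem continuous_twoStepPath : Continuous twoStepPath := by
  refine continuous_clm_apply.mpr fun x => (PiLp.continuous_toLp 2 _).comp ?_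
  refine continuous_pi fun i => ?_
  fin_cases i <;> simp <;> fun_prop

theorem twoStepPath_sq (t : ℝ) (x : 𝔼) : twoStepPath t (twoStepPath t x) = -x := by
  ext i
  fin_cases i <;> simp [twoStepPath_apply]

/-- The complex structure with `e₀ ↦ e₃`, `e₁ ↦ e₅`, `e₂ ↦ t e₂ - (1 + t²) e₄`, `e₄ ↦ e₂ - t e₄`. -/
def upperTriangularPath (t : ℝ) : 𝔼 →L[ℝ] 𝔼 := LinearMap.toContinuousLinearMap
  { toFun := fun x => !₂[-x 3, -x 5, t * x 2 + x 4, x 0, -((1 + t ^ 2) * x 2) - t * x 4, x 1]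
    map_add' := fun x y => by ext i; fin_cases i <;> simp <;> ring
    map_smul' := fun r x => by ext i; fin_cases i <;> simp <;> ring }

theorem upperTriangularPath_apply (t : ℝ) (x : 𝔼) : upperTriangularPath t x =
    !₂[-x 3, -x 5, t * x 2 + x 4, x 0, -((1 + t ^ 2) * x 2) - t * x 4, x 1] := rfl

theorem continuous_upperTriangularPath : Continuous upperTriangularPath := by
  refine continuous_clm_apply.mpr fun x => (PiLp.continuous_toLp 2 _).comp ?_
  refine continuous_pi fun i => ?_
  fin_cases i <;> simp <;> fun_prop

theorem upperTriangularPath_sq (t : ℝ) (x : 𝔼) :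
    upperTriangularPath t (upperTriangularPath t x) = -x := by
  ext i
  fin_cases i <;> simp [upperTriangularPath_apply] <;> ring

theorem finrank_twoStep_zero (a b c : ℤ) :
    Module.finrank ℝ ((twoStep a b c).linearNijenhuisImage (twoStepPath 0)) =
      2 * if a = b then 0 else 1 := by
  have hf : LinearIndependent ℝ ![(!₂[0, 0, 0, 1, 0, 0] : 𝔼), !₂[0, 0, 0, 0, 1, 0]] := by
    rw [Fintype.linearIndependent_iff]
    intro g hg i
    have h3 := congrArg (fun v : 𝔼 => v 3) hg
    have h4 := congrArg (fun v : 𝔼 => v 4) hg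
    simp at h3 h4
    fin_cases i <;> simp [h3, h4]
  -- The coefficients are the real and imaginary parts of `u(x) w(y) - u(y) w(x)`, up to sign, for
  -- the complex coordinates `u = x₀ + i x₁` and `w = x₂ + i x₅`.
  rw [finrank_linearNijenhuisImage _ _ hf (fun _ => (a : ℝ) - b)
    (fun x y => ![-((x 0 * y 2 - x 1 * y 5) - (y 0 * x 2 - y 1 * x 5)),
      (x 0 * y 5 + x 1 * y 2) - (y 0 * x 5 + y 1 * x 2)]) ?_ ![-1, 1] ?_
    ![!₂[1, 0, 0, 0, 0, 0], !₂[0, 1, 0, 0, 0, 0]]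
    ![!₂[0, 0, 1, 0, 0, 0], !₂[0, 0, 1, 0, 0, 0]] ?_]
  · simp [sub_eq_zero]
  · intro x y
    ext i
    fin_cases i <;> simp [linearNijenhuis, twoStep_bracket, twoStepPath_apply] <;> ring
  · intro i
    fin_cases i <;> simp
  · intro i
    ext k
    fin_cases i <;> fin_cases k <;>
      simp [linearNijenhuis, twoStep_bracket, twoStepPath_apply]

theorem finrank_twoStep_ne_zero (a b c : ℤ) {t : ℝ} (ht : t ≠ 0) :
    Module.finrank ℝ ((twoStep a b c).linearNijenhuisImage (twoStepPath t)) =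
      2 * ((if a = 0 then 0 else 1) + (if b = 0 then 0 else 1) + (if c = 0 then 0 else 1)) := by
  have hf : LinearIndependent ℝ ![(!₂[0, 0, 0, 1, 0, 0] : 𝔼), !₂[-t, 0, 0, 0, 1, 0],
      !₂[0, 0, 0, 0, 1, 0], !₂[0, t, 0, -1, 0, 0], !₂[0, 0, 0, 0, 0, 1],
      !₂[0, 0, -1, 0, 0, 0]] := by
    rw [Fintype.linearIndependent_iff]
    intro g hg i
    have h0 := congrArg (fun v : 𝔼 => v 0) hg
    have h1 := congrArg (fun v : 𝔼 => v 1) hg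
    have h2 := congrArg (fun v : 𝔼 => v 2) hg
    have h3 := congrArg (fun v : 𝔼 => v 3) hg
    have h4 := congrArg (fun v : 𝔼 => v 4) hg
    have h5 := congrArg (fun v : 𝔼 => v 5) hg
    simp [Fin.sum_univ_six, ht] at h0 h1 h2 h3 h4 h5
    simp [h0, h1] at h3 h4
    fin_cases i <;> simp [h0, h1, h2, h3, h4, h5]
  -- The basis is `z, j z` for `z = e₃, e₄, e₅`. The coefficients come from
  -- `N(x, y) = ([j x, j y] - [x, y]) - j ([j x, y] + [x, j y])`, and the values are those of `N` at
  -- pairs of vectors of `j ⟨e₃, e₄, e₅⟩`, or of one such vector and one of `⟨e₃, e₄, e₅⟩`.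
  rw [finrank_linearNijenhuisImage _ _ hf ![(a : ℝ), a, b, b, c, c]
    (fun x y =>
      let u := twoStepPath t x
      let v := twoStepPath t y
      ![(u 0 * v 2 - v 0 * u 2) - (x 0 * y 2 - y 0 * x 2),
        -((u 0 * y 2 - y 0 * u 2) + (x 0 * v 2 - v 0 * x 2)),
        (u 1 * v 2 - v 1 * u 2) - (x 1 * y 2 - y 1 * x 2),
        -((u 1 * y 2 - y 1 * u 2) + (x 1 * v 2 - v 1 * x 2)),
        (u 0 * v 1 - v 0 * u 1) - (x 0 * y 1 - y 0 * x 1),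
        -((u 0 * y 1 - y 0 * u 1) + (x 0 * v 1 - v 0 * x 1))]) ?_
    ![t, t, -t, -t, t ^ 2, t ^ 2] ?_
    ![!₂[-t, 0, 0, 0, 1, 0], !₂[0, 0, 0, 1, 0, 0], !₂[0, t, 0, -1, 0, 0], !₂[0, 0, 0, 0, 1, 0],
      !₂[-t, 0, 0, 0, 1, 0], !₂[0, 0, 0, 1, 0, 0]]
    ![!₂[0, 0, 1, 0, 0, 0], !₂[0, 0, 1, 0, 0, 0], !₂[0, 0, 1, 0, 0, 0], !₂[0, 0, 1, 0, 0, 0],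
      !₂[0, t, 0, -1, 0, 0], !₂[0, t, 0, -1, 0, 0]] ?_]
  · simp [Fin.sum_univ_six]
    split_ifs <;> simp
  · intro x y
    ext i
    fin_cases i <;>
      simp [linearNijenhuis, twoStep_bracket, twoStepPath_apply, Fin.sum_univ_six] <;> ring
  · intro i
    fin_cases i <;> simp [ht]
  · intro i
    ext k
    fin_cases i <;> fin_cases k <;>
      simp [linearNijenhuis, twoStep_bracket, twoStepPath_apply] <;> ring

theorem finrank_upperTriangular (t : ℝ) :
    Module.finrank ℝ (upperTriangular.linearNijenhuisImage (upperTriangularPath t)) =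
      2 * if t = 0 then 2 else 3 := by
  have hf : LinearIndependent ℝ ![(!₂[0, 0, 0, 1, 0, 0] : 𝔼), !₂[-1, 0, 0, 0, 0, 0],
      !₂[0, 0, 0, 0, 1, 0], !₂[0, 0, 1, 0, -t, 0], !₂[0, 0, 0, 0, 0, 1],
      !₂[0, -1, 0, 0, 0, 0]] := by
    rw [Fintype.linearIndependent_iff]
    intro g hg i
    have h0 := congrArg (fun v : 𝔼 => v 0) hg
    have h1 := congrArg (fun v : 𝔼 => v 1) hg
    have h2 := congrArg (fun v : 𝔼 => v 2) hg
    have h3 := congrArg (fun v : 𝔼 => v 3) hg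
    have h4 := congrArg (fun v : 𝔼 => v 4) hg
    have h5 := congrArg (fun v : 𝔼 => v 5) hg
    simp [Fin.sum_univ_six] at h0 h1 h2 h3 h4 h5
    simp [h2] at h4
    fin_cases i <;> simp [h0, h1, h2, h3, h4, h5]
  have ht : 1 + t ^ 2 ≠ 0 := by positivity
  -- The basis is `z, j z` for `z = e₃, e₄, e₅`. The image is generated over `ℂ` by
  -- `N(e₀, e₁) = -e₃`, `N(e₁, e₂) = -(1 + t j) e₄` and `N(e₀, e₂) = t (1 + t j) e₅`. The arguments
  -- in the last two come combined so as to remove the factor `1 + t j`, of square norm `1 + t ^ 2`.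
  rw [finrank_linearNijenhuisImage _ _ hf ![1, 1, 1, 1, t, t]
    (fun x y =>
      let u := upperTriangularPath t x
      let v := upperTriangularPath t y
      ![(u 0 * v 1 - v 0 * u 1) - (x 0 * y 1 - y 0 * x 1),
        -((u 0 * y 1 - y 0 * u 1) + (x 0 * v 1 - v 0 * x 1)),
        (u 1 * v 2 - v 1 * u 2) - (x 1 * y 2 - y 1 * x 2),
        -((u 1 * y 2 - y 1 * u 2) + (x 1 * v 2 - v 1 * x 2)),
        (t * (x 3 * y 2) + x 3 * y 4 + x 0 * y 2) - (t * (y 3 * x 2) + y 3 * x 4 + y 0 * x 2),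
        t * (x 0 * y 2 - y 0 * x 2) + (x 0 * y 4 - y 0 * x 4) - (x 3 * y 2 - y 3 * x 2)]) ?_
    ![-1, 1, 1 + t ^ 2, 1 + t ^ 2, 1 + t ^ 2, 1 + t ^ 2] ?_
    ![!₂[1, 0, 0, 0, 0, 0], !₂[0, 0, 0, 1, 0, 0], !₂[0, 0, 1, 0, 0, 0], !₂[0, 0, 1, 0, 0, 0],
      !₂[1, 0, 0, t, 0, 0], !₂[t, 0, 0, -1, 0, 0]]
    ![!₂[0, 1, 0, 0, 0, 0], !₂[0, 1, 0, 0, 0, 0], !₂[0, 1, 0, 0, 0, t], !₂[0, t, 0, 0, 0, -1],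
      !₂[0, 0, 1, 0, 0, 0], !₂[0, 0, 1, 0, 0, 0]] ?_]
  · by_cases h : t = 0 <;> simp [Fin.sum_univ_six, h]
  · intro x y
    ext i
    fin_cases i <;>
      simp [linearNijenhuis, upperTriangular_bracket, upperTriangularPath_apply,
        Fin.sum_univ_six] <;> ring
  · intro i
    fin_cases i <;> simp [ht]
  · intro i
    ext k
    fin_cases i <;> fin_cases k <;>
      simp [linearNijenhuis, upperTriangular_bracket, upperTriangularPath_apply] <;> ring

theorem exists_leftInvariant_twoStep (a b c : ℤ) {k₀ k₁ : ℕ} (h₀ : (if a = b then 0 else 1) = k₀)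
    (h₁ : (if a = 0 then 0 else 1) + (if b = 0 then 0 else 1) + (if c = 0 then 0 else 1) = k₁) :
    ∃ (N : Nilmanifold 6) (J₀ : AlmostComplexStructure 6 N.M),
      N.IsLeftInvariant J₀ ∧ J₀.HasRank k₀ ∧
        ∀ U ∈ 𝓝 J₀, ∃ J ∈ U, N.IsLeftInvariant J ∧ J.HasRank k₁ :=
  exists_leftInvariant_of_path (twoStep a b c) continuous_twoStepPath twoStepPath_sq
    (h₀ ▸ finrank_twoStep_zero a b c) (fun _ ht => h₁ ▸ finrank_twoStep_ne_zero a b c ht)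

/-- The path of structures on upper triangular matrices, run along `s : ℝ → ℝ`. -/
theorem exists_leftInvariant_upperTriangular (s : ℝ → ℝ) (hs : Continuous s) {k₀ k₁ : ℕ}
    (h₀ : (if s 0 = 0 then 2 else 3) = k₀)
    (h₁ : ∀ t, t ≠ 0 → (if s t = 0 then 2 else 3) = k₁) :
    ∃ (N : Nilmanifold 6) (J₀ : AlmostComplexStructure 6 N.M),
      N.IsLeftInvariant J₀ ∧ J₀.HasRank k₀ ∧
        ∀ U ∈ 𝓝 J₀, ∃ J ∈ U, N.IsLeftInvariant J ∧ J.HasRank k₁ :=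
  exists_leftInvariant_of_path upperTriangular (continuous_upperTriangularPath.comp hs)
    (fun t => upperTriangularPath_sq (s t)) (h₀ ▸ finrank_upperTriangular (s 0))
    (fun t ht => h₁ t ht ▸ finrank_upperTriangular (s t))

end NilpotentAlgebra

end Nilmanifolds

end

theorem proposition4p17 (k₀ k₁ : ℕ) (hk : k₀ ≤ k₁) (hk₁ : k₁ ≤ 3) :
    ∃ (N : Nilmanifolds.Nilmanifold 6) (J₀ : Nilmanifolds.AlmostComplexStructure 6 N.M),
      N.IsLeftInvariant J₀ ∧ J₀.HasRank k₀ ∧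
        ∀ U ∈ 𝓝 J₀, ∃ J ∈ U, N.IsLeftInvariant J ∧ J.HasRank k₁ := by
  have twoStep := @Nilmanifolds.NilpotentAlgebra.exists_leftInvariant_twoStep
  have upperTriangular := @Nilmanifolds.NilpotentAlgebra.exists_leftInvariant_upperTriangular
  rcases Nat.lt_or_ge k₀ 2 with h | h
  · interval_cases k₁ <;> interval_cases k₀
    · exact twoStep 0 0 0 (by simp) (by simp)
    · exact twoStep 0 0 1 (by simp) (by simp)
    · exact twoStep 1 0 0 (by simp) (by simp)
    · exact twoStep 1 1 0 (by simp) (by simp)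
    · exact twoStep 1 (-1) 0 (by simp) (by simp)
    · exact twoStep 1 1 1 (by simp) (by simp)
    · exact twoStep 1 (-1) 1 (by simp) (by simp)
  · interval_cases k₁ <;> interval_cases k₀
    · exact upperTriangular (fun _ => 0) continuous_const (by simp) (fun _ _ => by simp)
    · exact upperTriangular id continuous_id (by simp) (fun t ht => by simp [ht])
    · exact upperTriangular (fun _ => 1) continuous_const (by simp) (fun _ _ => by simp)
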